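/- Let $n,m,k\ge 0$ be integers and $A\in\mathbb R^{n\times n}$, $B\in\mathbb R^{n\times m}$, $V\in\mathbb R^{n\times k}$. Write $\mathbb S^n$ for the symmetric real $n\times n$ matrices, $\succ,\succeq,\prec,\preceq$ for the Loewner order, $A_F=A+BF$, and let $J:\mathbb R\times\mathbb R^{m\times n}\times\mathbb S^n\times\mathbb R^{k\times k}\to\mathbb R$ and $\Pi:\mathbb S^n\times\mathbb R\to\mathbb S^n$. Assume that for every $\alpha$ the map $P\mapsto\Pi(P,\alpha)$ is convex in the Loewner order on $\{P\succ0\}$; this covers every $\Pi$ that is affine in $P$, i.e. for which the first constraint below is a bilinear matrix inequality. Consider $$\min_{\alpha,F,P,X}\ J(\alpha,F,P,X)\quad\text{s.t.}\quad A_F^\top P+PA_F+\Pi(P,\alpha)\preceq 0,\quad VX-BFV=AV,\quad P\succ0,$$ over $\alpha\in\mathbb R$, $F\in\mathbb R^{m\times n}$, $P\in\mathbb S^n$, $X\in\mathbb R^{k\times k}$. Let $z^\star=(\alpha^\star,F^\star,P^\star,X^\star)$ be a locally optimal solution, let $J$ be differentiable at $z^\star$ and $\Pi$ at $(P^\star,\alpha^\star)$,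 and suppose that 1. there exists $P\succ 0$ such that $A_{F^\star}^\top P+PA_{F^\star}+\Pi(P,\alpha^\star)\prec 0$; 2. $V$ has full column rank and $\operatorname{im}V+\operatorname{im}B=\mathbb R^n$. Then $z^\star$ satisfies the KKT conditions: there are $Y,S\in\mathbb S^n$ with $Y\succeq0$, $S\succeq 0$ and $Z\in\mathbb R^{n\times k}$ such that $$\operatorname{tr}\bigl(Y(A_{F^\star}^\top P^\star+P^\star A_{F^\star}+\Pi(P^\star,\alpha^\star))\bigr)=0,\qquad \operatorname{tr}(SP^\star)=0,$$ and the derivative at $z^\star$ with respect to $(\alpha,F,P,X)$ of the Lagrangian $$J(\alpha,F,P,X)+\operatorname{tr}\bigl(Y(A_F^\top P+PA_F+\Pi(P,\alpha))\bigr)-\operatorname{tr}(SP)+\operatorname{tr}\bigl(Z^\top(VX-BFV-AV)\bigr)$$ is zero. -/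

import Mathlib

open Matrix

attribute [local instance] Matrix.frobeniusNormedAddCommGroup Matrix.frobeniusNormedSpace

/-- The real vector space `𝕊ⁿ` of symmetric `n × n` real matrices. -/
abbrev SymMat (n : ℕ) : Type :=
  selfAdjoint.submodule ℝ (Matrix (Fin n) (Fin n) ℝ)

/-- The space of decision variables `z = (α, F, P, X)`, with
`α ∈ ℝ`, `F ∈ ℝ^{m×n}`, `P ∈ 𝕊ⁿ`, `X ∈ ℝ^{k×k}`. -/
abbrev DecVar (n m k : ℕ) : Type :=
  ℝ × Matrix (Fin m) (Fin n) ℝ × SymMat n × Matrix (Fin k) (Fin k) ℝ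

/-- The data of the program
`min J(α, F, P, X)` s.t. `A_Fᵀ P + P A_F + Π(P, α) ⪯ 0`, `V X - B F V = A V`, `P ≻ 0`,
where `A_F = A + B F`. The map `Π` is called `Perf`. -/
structure DDProgram (n m k : ℕ) where
  A : Matrix (Fin n) (Fin n) ℝ
  B : Matrix (Fin n) (Fin m) ℝ
  V : Matrix (Fin n) (Fin k) ℝ
  J : DecVar n m k → ℝ
  Perf : SymMat n × ℝ → SymMat n

namespace DDProgram

variable {n m k : ℕ} (p : DDProgram n m k)

/-- The closed-loop matrix `A_F = A + B F`. -/
def closedLoop (F : Matrix (Fin m) (Fin n) ℝ) : Matrix (Fin n) (Fin n) ℝ :=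
  p.A + p.B * F

/-- The left-hand side `A_Fᵀ P + P A_F + Π(P, α)` of the Lyapunov-type inequality. -/
def lyap (α : ℝ) (F : Matrix (Fin m) (Fin n) ℝ) (P : SymMat n) : Matrix (Fin n) (Fin n) ℝ :=
  (p.closedLoop F)ᵀ * (P : Matrix (Fin n) (Fin n) ℝ)
    + (P : Matrix (Fin n) (Fin n) ℝ) * p.closedLoop F
    + (p.Perf (P, α) : Matrix (Fin n) (Fin n) ℝ)

/-- The residual `V X - B F V - A V` of the disturbance decoupling equation. -/
def ddResidual (F : Matrix (Fin m) (Fin n) ℝ) (X : Matrix (Fin k) (Fin k) ℝ) :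
    Matrix (Fin n) (Fin k) ℝ :=
  p.V * X - p.B * F * p.V - p.A * p.V

/-- The feasible set. -/
def feasible : Set (DecVar n m k) :=
  {z | (-(p.lyap z.1 z.2.1 z.2.2.1)).PosSemidef ∧
    p.V * z.2.2.2 - p.B * z.2.1 * p.V = p.A * p.V ∧
    (z.2.2.1 : Matrix (Fin n) (Fin n) ℝ).PosDef}

/-- `z` is a locally optimal solution. -/
def IsLocallyOptimal (z : DecVar n m k) : Prop :=
  z ∈ p.feasible ∧ IsLocalMinOn p.J p.feasible z

/-- The Lagrangian
`J(z) + tr(Y (A_Fᵀ P + P A_F + Π(P, α))) - tr(S P) + tr(Zᵀ (V X - B F V - A V))`. -/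
noncomputable def lagrangian (Y S : SymMat n) (Z : Matrix (Fin n) (Fin k) ℝ)
    (z : DecVar n m k) : ℝ :=
  p.J z
    + ((Y : Matrix (Fin n) (Fin n) ℝ) * p.lyap z.1 z.2.1 z.2.2.1).trace
    - ((S : Matrix (Fin n) (Fin n) ℝ) * (z.2.2.1 : Matrix (Fin n) (Fin n) ℝ)).trace
    + (Zᵀ * p.ddResidual z.2.1 z.2.2.2).trace

/-- `z` satisfies the KKT conditions: primal feasibility, and there are multipliers that are
dual feasible, complementary, and make the Lagrangian stationary at `z`. -/
def IsKKT (z : DecVar n m k) : Prop :=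
  z ∈ p.feasible ∧
  ∃ (Y S : SymMat n) (Z : Matrix (Fin n) (Fin k) ℝ),
    (Y : Matrix (Fin n) (Fin n) ℝ).PosSemidef ∧
    (S : Matrix (Fin n) (Fin n) ℝ).PosSemidef ∧
    ((Y : Matrix (Fin n) (Fin n) ℝ) * p.lyap z.1 z.2.1 z.2.2.1).trace = 0 ∧
    ((S : Matrix (Fin n) (Fin n) ℝ) * (z.2.2.1 : Matrix (Fin n) (Fin n) ℝ)).trace = 0 ∧
    HasFDerivAt (p.lagrangian Y S Z) (0 : DecVar n m k →L[ℝ] ℝ) z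

/-- For every `α`, the map `P ↦ Π(P, α)` is convex on the positive definite matrices with respect
to the Loewner order. Maps that are affine in `P` satisfy this. -/
def PerfConvex : Prop :=
  ∀ (α : ℝ) (P Q : SymMat n),
    (P : Matrix (Fin n) (Fin n) ℝ).PosDef → (Q : Matrix (Fin n) (Fin n) ℝ).PosDef →
    ∀ s t : ℝ, 0 ≤ s → 0 ≤ t → s + t = 1 →
      ((s • p.Perf (P, α) + t • p.Perf (Q, α) - p.Perf (s • P + t • Q, α) : SymMat n) :
        Matrix (Fin n) (Fin n) ℝ).PosSemidef

end DDProgram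

/-! The condition `P ≻ 0` is open, hence inactive at a feasible point, and `S = 0` serves. By
convexity of `Π` in `P`, the direction `(0, 0, P' - P, 0)` makes the linearised matrix inequality
strict; it moves neither `F` nor `X`, so it respects the linear equation. This is Slater's condition
for the linearised program (`neg_add_deriv_mem_posDefCone`). All such strict directions are tangent
to the feasible set, so local optimality makes the derivative of `J` nonnegative on them, and
Hahn–Banach separation yields `Y` (`exists_dual_multiplier`). The derivative of `J` plus the `Y`
term then vanishes on the kernel of `ddLinear`, hence factors through `ddLinear`; the factor gives
`Z`. -/

open Filter Topology

/-! ### The positive definite cone -/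

/-- Positive definiteness only has to be tested on the compact set of unit vectors. -/
theorem posDef_iff_forall_mem_sphere {n : ℕ} (M : SymMat n) :
    (M : Matrix (Fin n) (Fin n) ℝ).PosDef ↔
      ∀ y ∈ Metric.sphere (0 : Fin n → ℝ) 1,
        0 < y ⬝ᵥ ((M : Matrix (Fin n) (Fin n) ℝ) *ᵥ y) := by
  constructor
  · intro h y hy
    have hy0 : y ≠ 0 := by
      rintro rfl
      simp at hy
    simpa using h.dotProduct_mulVec_pos hy0
  · intro h
    refine Matrix.PosDef.of_dotProduct_mulVec_pos M.2 fun x hx => ?_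
    have hx' : 0 < ‖x‖ := norm_pos_iff.2 hx
    have h1 := h (‖x‖⁻¹ • x) (by simp [norm_smul, hx'.ne'])
    rw [mulVec_smul, smul_dotProduct, dotProduct_smul, smul_eq_mul, smul_eq_mul] at h1
    have h2 := (pos_iff_pos_of_mul_pos h1).1 (by positivity)
    have h3 := (pos_iff_pos_of_mul_pos h2).1 (by positivity)
    simpa using h3

/-- The cone of positive definite matrices inside `𝕊ⁿ`. -/
def posDefCone (n : ℕ) : Set (SymMat n) :=
  {M | (M : Matrix (Fin n) (Fin n) ℝ).PosDef}

/-- Compactness of the unit sphere makes the pointwise strict inequalities stable under one common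
perturbation of the matrix. -/
theorem isOpen_posDefCone (n : ℕ) : IsOpen (posDefCone n) := by
  rw [isOpen_iff_eventually]
  intro M hM
  have hM' := (posDef_iff_forall_mem_sphere M).1 hM
  have hcont : Continuous fun q : SymMat n × (Fin n → ℝ) =>
      q.2 ⬝ᵥ ((q.1 : Matrix (Fin n) (Fin n) ℝ) *ᵥ q.2) := by
    have h1 : Continuous fun q : SymMat n × (Fin n → ℝ) =>
      (q.1 : Matrix (Fin n) (Fin n) ℝ) := continuous_subtype_val.comp continuous_fst
    exact continuous_snd.dotProduct (h1.matrix_mulVec continuous_snd)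
  have := (isCompact_sphere (0 : Fin n → ℝ) 1).eventually_forall_of_forall_eventually
    (x₀ := M) (P := fun N y => 0 < y ⬝ᵥ ((N : Matrix (Fin n) (Fin n) ℝ) *ᵥ y))
    fun y hy => hcont.continuousAt.eventually (lt_mem_nhds (hM' y hy))
  filter_upwards [this] with N hN
  exact (posDef_iff_forall_mem_sphere N).2 hN

theorem smul_mem_posDefCone {n : ℕ} {c : ℝ} (hc : 0 < c) {M : SymMat n}
    (hM : M ∈ posDefCone n) : c • M ∈ posDefCone n :=
  Matrix.PosDef.smul (x := (M : Matrix (Fin n) (Fin n) ℝ)) hM hc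

theorem add_mem_posDefCone {n : ℕ} {M N : SymMat n} (hM : M ∈ posDefCone n)
    (hN : (N : Matrix (Fin n) (Fin n) ℝ).PosSemidef) : M + N ∈ posDefCone n :=
  Matrix.PosDef.add_posSemidef (A := (M : Matrix (Fin n) (Fin n) ℝ)) hM hN

theorem convex_posDefCone (n : ℕ) : Convex ℝ (posDefCone n) := by
  rw [convex_iff_forall_pos]
  intro M hM N hN a b ha hb _
  exact add_mem_posDefCone (smul_mem_posDefCone ha hM)
    (Matrix.PosDef.posSemidef (smul_mem_posDefCone hb hN))

theorem mem_closure_posDefCone {n : ℕ} {N : SymMat n}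
    (hN : (N : Matrix (Fin n) (Fin n) ℝ).PosSemidef) : N ∈ closure (posDefCone n) := by
  let e : SymMat n := ⟨1, Matrix.isHermitian_one⟩
  have he : e ∈ posDefCone n := Matrix.PosDef.one
  have ht : Tendsto (fun t : ℝ => t • e + N) (𝓝[>] 0) (𝓝 N) := by
    have : Continuous fun t : ℝ => t • e + N := by fun_prop
    simpa using (this.tendsto 0).mono_left nhdsWithin_le_nhds
  refine mem_closure_of_tendsto ht ?_
  filter_upwards [self_mem_nhdsWithin] with t ht
  exact add_mem_posDefCone (smul_mem_posDefCone ht he) hN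

theorem isClosed_posSemidef (n : ℕ) :
    IsClosed {M : SymMat n | (M : Matrix (Fin n) (Fin n) ℝ).PosSemidef} := by
  have : {M : SymMat n | (M : Matrix (Fin n) (Fin n) ℝ).PosSemidef} =
      ⋂ x : Fin n → ℝ, {M : SymMat n | 0 ≤ x ⬝ᵥ ((M : Matrix (Fin n) (Fin n) ℝ) *ᵥ x)} := by
    ext M
    simp only [Set.mem_ofPred_eq, Set.mem_iInter]
    exact ⟨fun h x => by simpa using h.dotProduct_mulVec_nonneg x, fun h =>
      Matrix.PosSemidef.of_dotProduct_mulVec_nonneg M.2 fun x => by simpa using h x⟩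
  rw [this]
  refine isClosed_iInter fun x => isClosed_le continuous_const ?_
  exact continuous_const.dotProduct (continuous_subtype_val.matrix_mulVec continuous_const)

/-! ### Trace duality -/

/-- Every linear functional on `𝕊ⁿ` is `M ↦ tr (Y M)` for some symmetric `Y`. -/
theorem exists_symMat_trace_eq {n : ℕ} (φ : SymMat n →ₗ[ℝ] ℝ) :
    ∃ Y : SymMat n, ∀ M : SymMat n,
      φ M = ((Y : Matrix (Fin n) (Fin n) ℝ) * (M : Matrix (Fin n) (Fin n) ℝ)).trace := by
  let T : SymMat n →ₗ[ℝ] Module.Dual ℝ (SymMat n) :=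
    LinearMap.mk₂ ℝ (fun Y M => ((Y : Matrix (Fin n) (Fin n) ℝ) * (M : Matrix _ _ ℝ)).trace)
      (by intros; simp [add_mul]) (by intros; simp) (by intros; simp [mul_add])
      (by intros; simp)
  -- Pairing `Y` with itself gives its squared Frobenius norm; equality of dimensions then gives
  -- surjectivity.
  have hT : Function.Injective T := by
    rw [injective_iff_map_eq_zero]
    intro Y hY
    have h := LinearMap.congr_fun hY Y
    have hs : (Y : Matrix (Fin n) (Fin n) ℝ)ᴴ = Y := Y.2
    ext1
    refine Matrix.trace_conjTranspose_mul_self_eq_zero_iff.1 ?_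
    rw [hs]
    exact h
  obtain ⟨Y, hY⟩ := (LinearMap.injective_iff_surjective_of_finrank_eq_finrank
    Subspace.dual_finrank_eq.symm).1 hT φ
  exact ⟨Y, fun M => by rw [← hY]; rfl⟩

/-- Every linear functional on `ℝ^{n×k}` is `M ↦ tr (Zᵀ M)` for some `Z`. -/
theorem exists_matrix_trace_eq {n k : ℕ} (φ : Matrix (Fin n) (Fin k) ℝ →ₗ[ℝ] ℝ) :
    ∃ Z : Matrix (Fin n) (Fin k) ℝ, ∀ M, φ M = (Zᵀ * M).trace := by
  let T : Matrix (Fin n) (Fin k) ℝ →ₗ[ℝ] Module.Dual ℝ (Matrix (Fin n) (Fin k) ℝ) :=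
    LinearMap.mk₂ ℝ (fun Z M => (Zᵀ * M).trace)
      (by intros; simp [Matrix.add_mul]) (by intros; simp) (by intros; simp [Matrix.mul_add])
      (by intros; simp)
  have hT : Function.Injective T := by
    rw [injective_iff_map_eq_zero]
    intro Z hZ
    refine Matrix.trace_conjTranspose_mul_self_eq_zero_iff.1 ?_
    rw [conjTranspose_eq_transpose_of_trivial]
    exact LinearMap.congr_fun hZ Z
  obtain ⟨Z, hZ⟩ := (LinearMap.injective_iff_surjective_of_finrank_eq_finrank
    Subspace.dual_finrank_eq.symm).1 hT φ
  exact ⟨Z, fun M => by rw [← hZ]; rfl⟩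

/-- Testing on the rank-one matrices `x xᵀ` recovers the quadratic form of `Y`. -/
theorem posSemidef_of_trace_mul_nonneg {n : ℕ} {Y : SymMat n}
    (h : ∀ M ∈ closure (posDefCone n),
      0 ≤ ((Y : Matrix (Fin n) (Fin n) ℝ) * (M : Matrix (Fin n) (Fin n) ℝ)).trace) :
    (Y : Matrix (Fin n) (Fin n) ℝ).PosSemidef := by
  refine Matrix.PosSemidef.of_dotProduct_mulVec_nonneg Y.2 fun x => ?_
  have hx : (vecMulVec x (star x)).PosSemidef := posSemidef_vecMulVec_self_star x
  have := h ⟨vecMulVec x (star x), hx.1⟩ (mem_closure_posDefCone hx)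
  rwa [mul_vecMulVec, trace_vecMulVec, dotProduct_comm] at this

/-! ### Separation and multipliers -/

/-- **Lagrange multipliers for a linearised conic program.** If `c` is nonnegative on all directions
`d ∈ K` for which `L + D d` lies in the negative of the open convex cone `C`, and such directions
exist, then there is a multiplier in the dual cone of `C` which is complementary to `L`. -/
theorem exists_dual_multiplier {E W : Type*} [AddCommGroup E] [Module ℝ E]
    [NormedAddCommGroup W] [NormedSpace ℝ W] {C : Set W} (hCo : IsOpen C) (hCc : Convex ℝ C)
    (hCs : ∀ t : ℝ, 0 < t → ∀ w ∈ C, t • w ∈ C)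
    (K : Submodule ℝ E) (D : E →ₗ[ℝ] W) (c : E →ₗ[ℝ] ℝ) {L : W} (hL : -L ∈ closure C)
    (hslater : ∃ d ∈ K, -(L + D d) ∈ C) (hopt : ∀ d ∈ K, -(L + D d) ∈ C → 0 ≤ c d) :
    ∃ φ : W →L[ℝ] ℝ, (∀ w ∈ closure C, 0 ≤ φ w) ∧ φ L = 0 ∧ ∀ d ∈ K, c d + φ (D d) = 0 := by
  obtain ⟨d₀, hd₀, hd₀C⟩ := hslater
  -- A common point of `s` and `t` would be a strictly feasible direction along which `c` is
  -- negative.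
  let s : Set (W × ℝ) := (Neg.neg ⁻¹' C) ×ˢ Set.Iio 0
  let t : Set (W × ℝ) := (fun d => (L + D d, c d)) '' (K : Set E)
  have hs : Convex ℝ s := by
    refine Convex.prod ?_ (convex_Iio 0)
    exact hCc.is_linear_preimage (f := Neg.neg) (IsLinearMap.isLinearMap_neg)
  have hso : IsOpen s := (hCo.preimage continuous_neg).prod isOpen_Iio
  have ht : Convex ℝ t := by
    rintro _ ⟨d, hd, rfl⟩ _ ⟨e, he, rfl⟩ a b ha hb hab
    refine ⟨a • d + b • e, K.add_mem (K.smul_mem a hd) (K.smul_mem b he), ?_⟩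
    ext
    · simp only [map_add, map_smul, Prod.fst_add, Prod.smul_fst, smul_add]
      nth_rewrite 1 [← one_smul ℝ L]
      rw [← hab, add_smul]
      abel
    · simp
  have hdisj : Disjoint s t := by
    rw [Set.disjoint_left]
    rintro _ ⟨h1, h2⟩ ⟨d, hd, rfl⟩
    exact absurd (hopt d hd h1) (not_le.2 h2)
  obtain ⟨f, u, hfs, hft⟩ := geometric_hahn_banach_open hs hso ht hdisj
  set lam := f (0, 1)
  let ψ : W →L[ℝ] ℝ := f.comp (ContinuousLinearMap.inl ℝ W ℝ)
  have hf : ∀ w r, f (w, r) = ψ w + r * lam := by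
    intro w r
    have : ((w, r) : W × ℝ) = (w, 0) + r • (0, 1) := by simp
    rw [this, map_add, map_smul]
    rfl
  have hsep : ∀ w ∈ C, ∀ r < 0, ∀ d ∈ K, -ψ w + r * lam < ψ (L + D d) + c d * lam := by
    intro w hw r hr d hd
    have h1 := hfs (-w, r) ⟨by simpa using hw, hr⟩
    have h2 := hft _ ⟨d, hd, rfl⟩
    rw [hf] at h1 h2
    rw [map_neg] at h1
    exact h1.trans_le h2
  -- A negative value of `ψ` could be scaled up inside the cone until it violates the separation
  -- bound.
  have hψC : ∀ w ∈ C, 0 ≤ ψ w := by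
    intro w hw
    by_contra! hneg
    set b := ψ (L + D 0) + c 0 * lam
    have hbound : ∀ a : ℝ, 0 < a → a * (-ψ w) - lam < b := by
      intro a ha
      have := hsep _ (hCs a ha w hw) (-1) (by norm_num) 0 K.zero_mem
      rw [map_smul, smul_eq_mul] at this
      linarith
    have h0 : 0 < -ψ w := by linarith
    have h1 := hbound ((|b + lam| + 1) / (-ψ w)) (by positivity)
    rw [div_mul_cancel₀ _ h0.ne'] at h1
    linarith [le_abs_self (b + lam)]
  -- At the Slater direction the `ψ` terms cancel; `lam ≤ 0` then fails once `r < c d₀`.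
  have hlam_pos : 0 < lam := by
    have key : ∀ r < 0, r * lam < c d₀ * lam := by
      intro r hr
      have := hsep _ hd₀C r hr d₀ hd₀
      rw [map_neg, neg_neg] at this
      linarith
    by_contra! hle
    have h1 := key (-(|c d₀| + 1)) (by linarith [abs_nonneg (c d₀)])
    nlinarith [neg_abs_le (c d₀)]
  have hweak : ∀ d ∈ K, 0 ≤ ψ (L + D d) + c d * lam := by
    intro d hd
    by_contra! hneg
    set b := ψ (L + D d) + c d * lam with hb
    set q := ψ (-(L + D d₀)) with hq
    have hq0 : 0 ≤ q := hψC _ hd₀C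
    -- Scaling the Slater point by this number, with `r` its negative, makes the left side of `hsep`
    -- equal `b / 2 > b`.
    have hpos : 0 < -b / (2 * (q + lam)) := by
      have : 0 < -b := by linarith
      positivity
    have := hsep _ (hCs _ hpos _ hd₀C) _ (neg_neg_of_pos hpos) d hd
    rw [map_smul, smul_eq_mul, ← hq, ← hb] at this
    have h2 : -b / (2 * (q + lam)) * (q + lam) = -b / 2 := by
      have : q + lam ≠ 0 := by positivity
      field_simp
    nlinarith
  have hψcl : ∀ w ∈ closure C, 0 ≤ ψ w := by
    intro w hw
    exact closure_minimal (t := {w | 0 ≤ ψ w}) hψC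
      (isClosed_le continuous_const ψ.continuous) hw
  have hψL : ψ L = 0 := by
    have h1 := hψcl _ hL
    have h2 := hweak 0 K.zero_mem
    simp only [map_neg, map_zero, add_zero, zero_mul] at h1 h2
    linarith
  refine ⟨lam⁻¹ • ψ, fun w hw => ?_, ?_, fun d hd => ?_⟩
  · exact mul_nonneg (inv_nonneg.2 hlam_pos.le) (hψcl w hw)
  · simp [hψL]
  -- `K` is a subspace, so the inequality holds for `d` and `-d` and is an equality.
  · have h1 := hweak d hd
    have h2 := hweak (-d) (K.neg_mem hd)
    simp only [map_add, map_neg, hψL] at h1 h2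
    have h3 : c d * lam + ψ (D d) = 0 := by linarith
    simp only [_root_.smul_apply, smul_eq_mul]
    field_simp
    linarith

/-- A linear functional vanishing on the kernel of a linear map factors through that map. -/
theorem exists_factor_of_vanish_on_ker {E W : Type*} [AddCommGroup E] [Module ℝ E]
    [AddCommGroup W] [Module ℝ W] (R : E →ₗ[ℝ] W) (g : E →ₗ[ℝ] ℝ)
    (h : ∀ d ∈ LinearMap.ker R, g d = 0) : ∃ χ : W →ₗ[ℝ] ℝ, ∀ d, χ (R d) = g d := by
  have hg : g ∈ LinearMap.range R.dualMap := by
    rw [LinearMap.range_dualMap_eq_dualAnnihilator_ker, Submodule.mem_dualAnnihilator]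
    exact h
  obtain ⟨χ, hχ⟩ := hg
  exact ⟨χ, fun d => LinearMap.congr_fun hχ d⟩

/-! ### The constraints and their linearisation -/

/-- The linear map `M ↦ M + Mᵀ` into the symmetric matrices. -/
def addTranspose (n : ℕ) : Matrix (Fin n) (Fin n) ℝ →ₗ[ℝ] SymMat n where
  toFun M := ⟨M + Mᵀ, Matrix.isHermitian_add_transpose_self M⟩
  map_add' M N := by
    ext1
    change (M + N) + (M + N)ᵀ = (M + Mᵀ) + (N + Nᵀ)
    rw [transpose_add]
    abel
  map_smul' c M := by
    ext1
    change c • M + (c • M)ᵀ = c • (M + Mᵀ)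
    rw [transpose_smul, smul_add]

namespace DDProgram

variable {n m k : ℕ} (p : DDProgram n m k)

/-- The constraint function `A_Fᵀ P + P A_F + Π(P, α)` as a map into `𝕊ⁿ`. -/
noncomputable def lyapSym (z : DecVar n m k) : SymMat n :=
  addTranspose n ((z.2.2.1 : Matrix (Fin n) (Fin n) ℝ) * p.closedLoop z.2.1)
    + p.Perf (z.2.2.1, z.1)

theorem coe_lyapSym (z : DecVar n m k) :
    (p.lyapSym z : Matrix (Fin n) (Fin n) ℝ) = p.lyap z.1 z.2.1 z.2.2.1 := by
  have hP : (z.2.2.1 : Matrix (Fin n) (Fin n) ℝ)ᵀ = z.2.2.1 := z.2.2.1.2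
  change _ + (_ * _)ᵀ + _ = _
  rw [lyap, transpose_mul, hP, add_comm (_ * p.closedLoop _)]

theorem differentiableAt_lyapSym {z : DecVar n m k}
    (h : DifferentiableAt ℝ p.Perf (z.2.2.1, z.1)) : DifferentiableAt ℝ p.lyapSym z := by
  let _ : NormedRing (Matrix (Fin n) (Fin n) ℝ) := Matrix.frobeniusNormedRing
  let _ : NormedAlgebra ℝ (Matrix (Fin n) (Fin n) ℝ) := Matrix.frobeniusNormedAlgebra
  have hP : DifferentiableAt ℝ
      (fun w : DecVar n m k => (w.2.2.1 : Matrix (Fin n) (Fin n) ℝ)) z := by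
    have : DifferentiableAt ℝ (fun w : DecVar n m k => w.2.2.1) z := by fun_prop
    exact (selfAdjoint.submodule ℝ (Matrix (Fin n) (Fin n) ℝ)).subtypeL.differentiableAt.comp z this
  have hF : DifferentiableAt ℝ (fun w : DecVar n m k => p.closedLoop w.2.1) z := by
    let T : Matrix (Fin m) (Fin n) ℝ →ₗ[ℝ] Matrix (Fin n) (Fin n) ℝ :=
      { toFun := fun F => p.B * F
        map_add' := fun _ _ => Matrix.mul_add _ _ _
        map_smul' := fun _ _ => Matrix.mul_smul _ _ _ }
    have h1 : DifferentiableAt ℝ (fun w : DecVar n m k => w.2.1) z := by fun_prop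
    exact (T.toContinuousLinearMap.differentiableAt.comp z h1).const_add p.A
  have hPF : DifferentiableAt ℝ
      (fun w : DecVar n m k => (w.2.2.1 : Matrix (Fin n) (Fin n) ℝ) * p.closedLoop w.2.1) z :=
    hP.mul hF
  have hPi : DifferentiableAt ℝ (fun w : DecVar n m k => p.Perf (w.2.2.1, w.1)) z :=
    h.comp z (f := fun w : DecVar n m k => (w.2.2.1, w.1)) (by fun_prop)
  exact ((addTranspose n).toContinuousLinearMap.differentiableAt.comp z hPF).add hPi

/-- The linear part `(α, F, P, X) ↦ V X - B F V` of the disturbance decoupling equation. -/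
def ddLinear : DecVar n m k →ₗ[ℝ] Matrix (Fin n) (Fin k) ℝ where
  toFun z := p.V * z.2.2.2 - p.B * z.2.1 * p.V
  map_add' z w := by
    simp only [Prod.snd_add, Prod.fst_add, Matrix.mul_add, Matrix.add_mul]
    abel
  map_smul' c z := by
    simp [smul_sub]

theorem ddResidual_eq (z : DecVar n m k) :
    p.ddResidual z.2.1 z.2.2.2 = p.ddLinear z - p.A * p.V := rfl

theorem mem_feasible_iff (z : DecVar n m k) :
    z ∈ p.feasible ↔ (-(p.lyapSym z : Matrix (Fin n) (Fin n) ℝ)).PosSemidef ∧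
      p.ddLinear z = p.A * p.V ∧ z.2.2.1 ∈ posDefCone n := by
  rw [coe_lyapSym]
  rfl

/-- Directions along which the linearised matrix inequality becomes strict, and which preserve the
linear equation, are feasible to first order. -/
theorem mem_posTangentConeAt_feasible {z d : DecVar n m k} {D : DecVar n m k →L[ℝ] SymMat n}
    (hz : z ∈ p.feasible) (hD : HasFDerivAt p.lyapSym D z) (hd : p.ddLinear d = 0)
    (hstrict : -(p.lyapSym z + D d) ∈ posDefCone n) : d ∈ posTangentConeAt p.feasible z := by
  rw [mem_feasible_iff] at hz
  refine mem_posTangentConeAt_of_frequently_mem (Eventually.frequently ?_)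
  have hslope := (hD.hasLineDerivAt d).tendsto_slope_zero_right
  have hlim : Tendsto (fun t : ℝ => -(p.lyapSym z + t⁻¹ • (p.lyapSym (z + t • d) - p.lyapSym z)))
      (𝓝[>] 0) (𝓝 (-(p.lyapSym z + D d))) := (tendsto_const_nhds.add hslope).neg
  have hP : Tendsto (fun t : ℝ => (z + t • d).2.2.1) (𝓝[>] 0) (𝓝 z.2.2.1) := by
    have : Continuous fun t : ℝ => (z + t • d).2.2.1 := by fun_prop
    simpa using (this.tendsto 0).mono_left nhdsWithin_le_nhds
  filter_upwards [hlim ((isOpen_posDefCone n).mem_nhds hstrict),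
    hP ((isOpen_posDefCone n).mem_nhds hz.2.2), Ioo_mem_nhdsGT one_pos] with t ht htP ht01
  rw [mem_feasible_iff]
  refine ⟨?_, ?_, htP⟩
  -- The new value is a convex combination of a positive definite matrix near the linearised value
  -- and the semidefinite `-p.lyapSym z`.
  · have hN : t • -(p.lyapSym z + t⁻¹ • (p.lyapSym (z + t • d) - p.lyapSym z)) +
        (1 - t) • -p.lyapSym z = -p.lyapSym (z + t • d) := by
      have := ht01.1.ne'
      match_scalars <;> field_simp
      ring
    have hmem := add_mem_posDefCone (smul_mem_posDefCone ht01.1 ht)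
      (N := (1 - t) • -p.lyapSym z)
      (Matrix.PosSemidef.smul (x := -(p.lyapSym z : Matrix (Fin n) (Fin n) ℝ)) hz.1
        (sub_nonneg.2 ht01.2.le))
    rw [hN] at hmem
    exact Matrix.PosDef.posSemidef hmem
  · rw [map_add, map_smul, hd, smul_zero, add_zero, hz.2.1]

/-- Convexity in `P` turns a strictly feasible `P'` into a strictly feasible direction of the
linearised matrix inequality. -/
theorem neg_add_deriv_mem_posDefCone (hconv : p.PerfConvex) {α : ℝ}
    {F : Matrix (Fin m) (Fin n) ℝ} {P P' : SymMat n} {X : Matrix (Fin k) (Fin k) ℝ}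
    {D : DecVar n m k →L[ℝ] SymMat n} (hD : HasFDerivAt p.lyapSym D (α, F, P, X))
    (hP : P ∈ posDefCone n) (hP' : P' ∈ posDefCone n) (hstrict : (-(p.lyap α F P')).PosDef) :
    -(p.lyapSym (α, F, P, X) + D (0, 0, P' - P, 0)) ∈ posDefCone n := by
  set L := p.lyapSym (α, F, P, X) with hL
  set L' := p.lyapSym (α, F, P', X) with hL'
  have hslope := (hD.hasLineDerivAt (0, 0, P' - P, 0)).tendsto_slope_zero_right
  have hlim := (tendsto_const_nhds (x := L' - L)).sub hslope
  -- The gradient inequality for a Loewner-convex map, as a limit of difference quotients.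
  have hpsd : L' - L - D (0, 0, P' - P, 0) ∈
      {M : SymMat n | (M : Matrix (Fin n) (Fin n) ℝ).PosSemidef} := by
    refine (isClosed_posSemidef n).mem_of_tendsto hlim ?_
    filter_upwards [Ioo_mem_nhdsGT one_pos] with t ht
    have hz : ((α, F, P, X) : DecVar n m k) + t • (0, 0, P' - P, 0) =
        (α, F, (1 - t) • P + t • P', X) := by
      ext1
      · simp
      · ext1
        · simp
        · ext1
          · simp only [Prod.snd_add, Prod.smul_snd, Prod.fst_add, Prod.smul_fst]
            module
          · simp
    -- With `F` fixed the Lyapunov terms are linear in `P` and cancel, leaving the convexity gap of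
    -- `Π`.
    have hgap : L' - L - t⁻¹ • (p.lyapSym (α, F, (1 - t) • P + t • P', X) - L) =
        t⁻¹ • ((1 - t) • p.Perf (P, α) + t • p.Perf (P', α)
          - p.Perf ((1 - t) • P + t • P', α)) := by
      have ht0 := ht.1.ne'
      simp only [hL, hL', lyapSym, Submodule.coe_add, Submodule.coe_smul, Matrix.add_mul,
        Matrix.smul_mul, map_add, map_smul]
      match_scalars <;> field_simp <;> ring
    rw [hz]
    change (↑(L' - L - t⁻¹ • (p.lyapSym (α, F, (1 - t) • P + t • P', X) - L)) :
      Matrix (Fin n) (Fin n) ℝ).PosSemidef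
    rw [hgap]
    exact (hconv α P P' hP hP' (1 - t) t (sub_nonneg.2 ht.2.le) ht.1.le (by ring)).smul
      (inv_nonneg.2 ht.1.le)
  have hN : -L' ∈ posDefCone n := by
    change (-(p.lyapSym (α, F, P', X) : Matrix (Fin n) (Fin n) ℝ)).PosDef
    rw [coe_lyapSym]
    exact hstrict
  have := add_mem_posDefCone hN hpsd
  rwa [show -L' + (L' - L - D (0, 0, P' - P, 0)) = -(L + D (0, 0, P' - P, 0)) by abel] at this

end DDProgram

/-! ### The KKT conditions -/

theorem theorem1 {n m k : ℕ} (p : DDProgram n m k)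
    (hconv : p.PerfConvex)
    (α : ℝ) (F : Matrix (Fin m) (Fin n) ℝ) (P : SymMat n) (X : Matrix (Fin k) (Fin k) ℝ)
    (hJ : DifferentiableAt ℝ p.J (α, F, P, X))
    (hPerf : DifferentiableAt ℝ p.Perf (P, α))
    (hstrict : ∃ P' : SymMat n, (P' : Matrix (Fin n) (Fin n) ℝ).PosDef ∧
      (-(p.lyap α F P')).PosDef)
    (hrank : p.V.rank = k)
    (him : LinearMap.range p.V.mulVecLin ⊔ LinearMap.range p.B.mulVecLin = ⊤)
    (hopt : p.IsLocallyOptimal (α, F, P, X)) :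
    p.IsKKT (α, F, P, X) := by
  obtain ⟨hfeas, hmin⟩ := hopt
  obtain ⟨P', hP', hlyap'⟩ := hstrict
  set z : DecVar n m k := (α, F, P, X)
  have hG := (p.differentiableAt_lyapSym (z := z) hPerf).hasFDerivAt
  set D := fderiv ℝ p.lyapSym z
  have hfeas' := (p.mem_feasible_iff z).1 hfeas
  obtain ⟨φ, hφ, hφz, hφK⟩ := exists_dual_multiplier (isOpen_posDefCone n) (convex_posDefCone n)
    (fun _ ht _ hw => smul_mem_posDefCone ht hw) (LinearMap.ker p.ddLinear)
    D.toLinearMap (fderiv ℝ p.J z).toLinearMap (L := p.lyapSym z)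
    (mem_closure_posDefCone hfeas'.1)
    ⟨(0, 0, P' - P, 0), by simp [DDProgram.ddLinear],
      p.neg_add_deriv_mem_posDefCone hconv hG hfeas'.2.2 hP' hlyap'⟩
    fun d hd hdC => hmin.hasFDerivWithinAt_nonneg hJ.hasFDerivAt.hasFDerivWithinAt
      (p.mem_posTangentConeAt_feasible hfeas hG hd hdC)
  obtain ⟨χ, hχ⟩ := exists_factor_of_vanish_on_ker p.ddLinear
    (-((fderiv ℝ p.J z).toLinearMap + φ.toLinearMap ∘ₗ D.toLinearMap))
    fun d hd => neg_eq_zero.2 (hφK d hd)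
  obtain ⟨Y, hY⟩ := exists_symMat_trace_eq φ.toLinearMap
  obtain ⟨Z, hZ⟩ := exists_matrix_trace_eq χ
  refine ⟨hfeas, Y, 0, Z, ?_, Matrix.PosSemidef.zero, ?_, by simp, ?_⟩
  · exact posSemidef_of_trace_mul_nonneg fun M hM => by
      rw [← hY]
      exact hφ M hM
  · rw [← DDProgram.coe_lyapSym, ← hY]
    exact hφz
  -- In terms of `φ` and `χ` the Lagrangian is differentiated by the chain rule, and `hχ` cancels
  -- the sum.
  · have hlag : p.lagrangian Y 0 Z = fun w => p.J w + φ (p.lyapSym w)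
        + ((χ ∘ₗ p.ddLinear).toContinuousLinearMap w - χ (p.A * p.V)) := by
      ext w
      have h1 := hY (p.lyapSym w)
      rw [DDProgram.coe_lyapSym] at h1
      rw [DDProgram.lagrangian, ← h1, p.ddResidual_eq, ← hZ, map_sub]
      simp
    rw [hlag]
    refine ((hJ.hasFDerivAt.add (φ.hasFDerivAt.comp z hG)).add
      ((ContinuousLinearMap.hasFDerivAt _).sub_const _)).congr_fderiv ?_
    refine ContinuousLinearMap.ext fun d => ?_
    have := hχ d
    simp only [LinearMap.neg_apply, LinearMap.add_apply, LinearMap.comp_apply] at this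
    change fderiv ℝ p.J z d + φ (D d) + χ (p.ddLinear d) = 0
    rw [this]
    exact add_neg_cancel _
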